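/- A *differential space* $(M,\mathscr F)$ is a topological space $M$ with a nonempty set $\mathscr F$ of functions $M\to\mathbb R$ such that (1) the topology of $M$ is the smallest one making all $f\in\mathscr F$ continuous; (2) $g\circ(f_1,\dots,f_m)\in\mathscr F$ for all $m\ge 0$, $g\in C^\infty(\mathbb R^m)$, $f_1,\dots,f_m\in\mathscr F$; (3) every function $M\to\mathbb R$ that agrees in a neighbourhood of each point with some element of $\mathscr F$ belongs to $\mathscr F$. A map $\varphi\colon(M,\mathscr F_M)\to(N,\mathscr F_N)$ is *smooth* if $f\circ\varphi\in\mathscr F_M$ for all $f\in\mathscr F_N$, and a *diffeomorphism* if it is invertible with smooth inverse. A subset $N\subseteq M$ carries the *subspace structure*, the smallest differential structure on $N$ containing the restrictions $f|_N$, $f\in\mathscr F$; a product $M_1\times M_2$ carries the *product structure*, the smallest one containing $\pi_1^*\mathscr F_1\cup\pi_2^*\mathscr F_2$. $\mathbb R^n$ carries $C^\infty(\mathbb R^n)$ and its subsets the subspace structure. A *derivation* of $\mathscr F$ is an $\mathbb R$-linear map $v\colon\mathscr F\to\mathscr F$ with $v(fg)=v(f)g+fv(g)$. An *integral curve* of $v$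 is a map $\gamma\colon J\to M$ from a connected set $J\subseteq\mathbb R$ with $0\in J$ such that either $J=\{0\}$, or $\gamma$ is smooth and $\frac{d}{dx}(f\circ\gamma)=v(f)\circ\gamma$ on $J$ for all $f\in\mathscr F$. It is *maximal* if for every integral curve $\tau\colon K\to M$ of $v$ with $\tau(0)=\gamma(0)$ we have $K\subseteq J$ and $\gamma|_K=\tau$. A *flow* of $v$ is a smooth map $\Phi\colon W\to M$, where $W\subseteq M\times\mathbb R$ is a subset containing $M\times\{0\}$ with the subspace structure of the product structure, such that for all $x\in M$: $\Phi(x,0)=x$; the set $I_x=\{t\in\mathbb R\mid (x,t)\in W\}$ is connected; and $\Phi(x,\cdot)\colon I_x\to M$ is a maximal integral curve of $v$. **Theorem.** Let $(M,\mathscr F)$ be a differential space diffeomorphic to a subset of some $\mathbb R^n$, and let $v\colon\mathscr F\to\mathscr F$ be a derivation. Then $v$ has a unique flow $\Phi\colon W\to M$ (both $W$ and $\Phi$ are unique). -/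

import Mathlib

open scoped ContDiff

noncomputable section

namespace Sikorski

/-- The initial topology of a set `A` of real-valued functions on `M`: the smallest topology
for which every function in `A` is continuous. -/
abbrev initialTopology {M : Type*} (A : Set (M → ℝ)) : TopologicalSpace M :=
  ⨅ f ∈ A, TopologicalSpace.induced f inferInstance

/-- A differential structure (in the sense of Sikorski) on `M`. The topology of the differential
space is by definition the initial topology of the set of functions, so it is not separate data:
a differential space is a type `M` together with a term of `DifferentialStructure M`. -/
structure DifferentialStructure (M : Type*) where
  /-- the "smooth functions by fiat" -/
  carrier : Set (M → ℝ)
  nonempty : carrier.Nonempty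
  /-- closure under composition with smooth functions of finitely many variables -/
  comp_mem : ∀ (m : ℕ) (g : (Fin m → ℝ) → ℝ), ContDiff ℝ ∞ g →
    ∀ f : Fin m → M → ℝ, (∀ i, f i ∈ carrier) → (fun x => g (fun i => f i x)) ∈ carrier
  /-- a function that agrees near every point with a function in the structure is in the
  structure -/
  local_mem : ∀ g : M → ℝ,
    (∀ p : M, ∃ U ∈ @nhds M (initialTopology carrier) p, ∃ a ∈ carrier, Set.EqOn g a U) →
    g ∈ carrier

theorem initialTopology_anti {M : Type*} {A B : Set (M → ℝ)} (h : A ⊆ B) :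
    initialTopology B ≤ initialTopology A :=
  biInf_mono h

namespace DifferentialStructure

variable {M N : Type*}

theorem const_mem (F : DifferentialStructure M) (c : ℝ) : (fun _ => c) ∈ F.carrier :=
  F.comp_mem 0 (fun _ => c) contDiff_const (fun i _ => i.elim0) (fun i => i.elim0)

/-- The `ℝ`-algebra of functions underlying a differential structure (pointwise operations). -/
def toSubalgebra (F : DifferentialStructure M) : Subalgebra ℝ (M → ℝ) where
  carrier := F.carrier
  mul_mem' := by
    intro a b ha hb
    have h := F.comp_mem 2 (fun y => y 0 * y 1) (by fun_prop) ![a, b]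
      (by intro i; fin_cases i <;> simpa)
    exact h
  add_mem' := by
    intro a b ha hb
    have h := F.comp_mem 2 (fun y => y 0 + y 1) (by fun_prop) ![a, b]
      (by intro i; fin_cases i <;> simpa)
    exact h
  algebraMap_mem' := fun c => F.const_mem c

/-- The differential structure generated by a set `A` of functions: the smallest differential
structure containing `A`, i.e. the intersection of all of them. -/
def generate (A : Set (M → ℝ)) : DifferentialStructure M where
  carrier := {f | ∀ G : DifferentialStructure M, A ⊆ G.carrier → f ∈ G.carrier}
  nonempty := ⟨fun _ => 0, fun G _ => G.const_mem 0⟩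
  comp_mem := fun m g hg f hf G hG => G.comp_mem m g hg f (fun i => hf i G hG)
  local_mem := by
    intro g hg G hG
    refine G.local_mem g fun p => ?_
    obtain ⟨U, hU, a, ha, hga⟩ := hg p
    refine ⟨U, ?_, a, ha G hG, hga⟩
    exact nhds_mono (initialTopology_anti fun f (hf : ∀ G : DifferentialStructure M,
      A ⊆ G.carrier → f ∈ G.carrier) => hf G hG) hU

/-- The subspace (induced) differential structure on a subset. -/
def subspace (F : DifferentialStructure M) (S : Set M) : DifferentialStructure S :=
  generate {g | ∃ f ∈ F.carrier, g = fun x : S => f x}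

/-- The product differential structure. -/
def prod (F : DifferentialStructure M) (G : DifferentialStructure N) :
    DifferentialStructure (M × N) :=
  generate ({h | ∃ f ∈ F.carrier, h = fun p => f p.1} ∪ {h | ∃ g ∈ G.carrier, h = fun p => g p.2})

/-- The standard differential structure on a finite-dimensional normed space: the smooth
functions. -/
def standard (E : Type*) [NormedAddCommGroup E] [NormedSpace ℝ E] [FiniteDimensional ℝ E] :
    DifferentialStructure E where
  carrier := {f | ContDiff ℝ ∞ f}
  nonempty := ⟨fun _ => 0, (contDiff_const : ContDiff ℝ ∞ (fun _ : E => (0 : ℝ)))⟩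
  comp_mem := fun _ _ hg _ hf => hg.comp (contDiff_pi.2 hf)
  local_mem := by
    intro g hg
    change ContDiff ℝ ∞ g
    refine contDiff_iff_contDiffAt.2 fun p => ?_
    obtain ⟨U, hU, a, ha, hga⟩ := hg p
    have hle : (inferInstance : TopologicalSpace E) ≤
        initialTopology {f : E → ℝ | ContDiff ℝ ∞ f} :=
      le_iInf₂ fun f (hf : ContDiff ℝ ∞ f) => continuous_iff_le_induced.1 hf.continuous
    have hU' : U ∈ nhds p := nhds_mono hle hU
    have ha' : ContDiff ℝ ∞ a := ha
    exact ha'.contDiffAt.congr_of_eventuallyEq (Filter.eventuallyEq_of_mem hU' hga)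

end DifferentialStructure

open DifferentialStructure

/-- Smooth maps of differential spaces. -/
def IsSmooth {M N : Type*} (F : DifferentialStructure M) (G : DifferentialStructure N)
    (φ : M → N) : Prop :=
  ∀ f ∈ G.carrier, f ∘ φ ∈ F.carrier

/-- Two differential spaces are diffeomorphic: there is an invertible smooth map with smooth
inverse. -/
def Diffeomorphic {M N : Type*} (F : DifferentialStructure M) (G : DifferentialStructure N) :
    Prop :=
  ∃ e : M ≃ N, IsSmooth F G e ∧ IsSmooth G F e.symm

/-- `g : J → ℝ`, a function on a subset `J` of the line, has derivative `c` at `t ∈ J`, as a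
limit of difference quotients inside `J`. The values off `J` of the extension of `g` by zero
are irrelevant. -/
def HasDerivOnAt (J : Set ℝ) (g : J → ℝ) (c : ℝ) (t : J) : Prop :=
  HasDerivWithinAt (Function.extend Subtype.val g 0) c J t

variable {M : Type*} {F : DifferentialStructure M}

/-- `γ : J → M` is an integral curve of the derivation `v`: its domain `J` is an interval
(a connected subset of the line) containing `0`, and either `J` is a single point, or `γ` is smooth
and `d/dx (f ∘ γ) = v(f) ∘ γ` for all `f` in the differential structure. -/
structure IsIntegralCurve (v : Derivation ℝ F.toSubalgebra F.toSubalgebra)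
    (J : Set ℝ) (γ : J → M) : Prop where
  zero_mem : (0 : ℝ) ∈ J
  connected : IsConnected J
  deriv_eq : J.Subsingleton ∨
    (IsSmooth ((standard ℝ).subspace J) F γ ∧
      ∀ (f : F.toSubalgebra) (t : J),
        HasDerivOnAt J (fun s => (f : M → ℝ) (γ s)) ((v f : M → ℝ) (γ t)) t)

/-- A maximal integral curve: every integral curve with the same starting point is a restriction
of it. -/
structure IsMaximalIntegralCurve (v : Derivation ℝ F.toSubalgebra F.toSubalgebra)
    (I : Set ℝ) (γ : I → M) : Prop extends IsIntegralCurve v I γ where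
  maximal : ∀ (K : Set ℝ) (τ : K → M) (hτ : IsIntegralCurve v K τ),
    τ ⟨0, hτ.zero_mem⟩ = γ ⟨0, zero_mem⟩ →
      ∃ h : K ⊆ I, ∀ t : K, γ ⟨t, h t.2⟩ = τ t

/-- `Φ : W → M` is a flow of the derivation `v`, where `W ⊆ M × ℝ` carries the subspace structure
of the product differential structure. -/
structure IsFlow (v : Derivation ℝ F.toSubalgebra F.toSubalgebra)
    (W : Set (M × ℝ)) (Φ : W → M) : Prop where
  smooth : IsSmooth ((F.prod (standard ℝ)).subspace W) F Φ
  zero_mem : ∀ x : M, (x, (0 : ℝ)) ∈ W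
  map_zero : ∀ x : M, Φ ⟨(x, 0), zero_mem x⟩ = x
  connected : ∀ x : M, IsConnected {t : ℝ | (x, t) ∈ W}
  maximal : ∀ x : M, IsMaximalIntegralCurve v {t : ℝ | (x, t) ∈ W} (fun t => Φ ⟨(x, t), t.2⟩)

end Sikorski

end

/-!
Through an embedding `x : M → ℝⁿ`, every smooth function on `M` is locally of the form `g ∘ x`, and
Hadamard's lemma applied to `g` shows that the derivation `v` is given by a vector field `b` along
`x` which extends, locally around each point, to a smooth vector field on `ℝⁿ`. Integral curves of
`v` are the solutions of `(x ∘ γ)' = b ∘ γ`. A partition of unity glues local extensions of `b`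
around the image of one such curve to a compactly supported smooth vector field on `ℝⁿ`. Its flow
exists for all times and is smooth, by the implicit function theorem applied to the Picard integral
equation on a space of continuous curves. Uniqueness for ordinary differential equations shows that
all nearby integral curves of `v` follow this flow, so that the union of all integral curves is
smooth; a flow is unique because its curves are maximal.
-/

open Set Filter Topology
open scoped NNReal Manifold

namespace Sikorski

section Postcomposition

universe u v

variable (K : Type*) [TopologicalSpace K] [CompactSpace K]

/-- Pointwise application of a continuous family of operators to a continuous family of vectors:
the form taken by the derivative of `γ ↦ f ∘ γ`. -/
noncomputable def pointwiseApply (E F : Type*) [NormedAddCommGroup E] [NormedSpace ℝ E]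
    [NormedAddCommGroup F] [NormedSpace ℝ F] : C(K, E →L[ℝ] F) →L[ℝ] C(K, E) →L[ℝ] C(K, F) :=
  LinearMap.mkContinuous₂
    (LinearMap.mk₂ ℝ
      (fun (A : C(K, E →L[ℝ] F)) (δ : C(K, E)) => (⟨fun k => A k (δ k), by fun_prop⟩ : C(K, F)))
      (fun _ _ _ => by ext; simp) (fun _ _ _ => by ext; simp)
      (fun _ _ _ => by ext; simp) (fun _ _ _ => by ext; simp)) 1 fun A δ => by
    refine (ContinuousMap.norm_le _ (by positivity)).2 fun k => ?_
    rw [one_mul]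
    exact (A k).le_of_opNorm_le_of_le (A.norm_coe_le_norm k) (δ.norm_coe_le_norm k)

-- Differentiation replaces `F` by `E →L[ℝ] F`, which has to live in the universe of `F`.
variable {K} {E : Type u} {F : Type (max u v)} [NormedAddCommGroup E] [NormedSpace ℝ E]
  [NormedAddCommGroup F] [NormedSpace ℝ F]

theorem hasFDerivAt_postcomp {f : C(E, F)} {f' : C(E, E →L[ℝ] F)}
    (hf : ∀ y, HasFDerivAt f (f' y) y) (γ : C(K, E)) :
    HasFDerivAt (fun γ : C(K, E) => f.comp γ) (pointwiseApply K E F (f'.comp γ)) γ := by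
  rw [hasFDerivAt_iff_isLittleO, Asymptotics.isLittleO_iff]
  intro ε hε
  obtain ⟨r, hr, hball⟩ : ∃ r > 0, ∀ δ : C(K, E), dist δ γ < r → dist (f'.comp δ) (f'.comp γ) < ε :=
    Metric.continuousAt_iff.1 (ContinuousMap.continuous_postcomp f').continuousAt ε hε
  filter_upwards [Metric.ball_mem_nhds γ hr] with δ hδ
  refine (ContinuousMap.norm_le _ (by positivity)).2 fun k => ?_
  have hsegment : ∀ y ∈ segment ℝ (γ k) (δ k), ‖f' y - f' (γ k)‖ ≤ ε := by
    rw [segment_eq_image']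
    rintro _ ⟨θ, hθ, rfl⟩
    have hclose : dist (γ + θ • (δ - γ)) γ < r := by
      rw [dist_eq_norm, add_sub_cancel_left, norm_smul, Real.norm_of_nonneg hθ.1, ← dist_eq_norm]
      exact (mul_le_of_le_one_left dist_nonneg hθ.2).trans_lt hδ
    rw [← dist_eq_norm]
    exact (ContinuousMap.dist_apply_le_dist k).trans (hball _ hclose).le
  calc ‖f (δ k) - f (γ k) - f' (γ k) (δ k - γ k)‖
      ≤ ε * ‖δ k - γ k‖ :=
        (convex_segment (γ k) (δ k)).norm_image_sub_le_of_norm_hasFDerivWithin_le'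
          (fun y _ => (hf y).hasFDerivWithinAt) hsegment (left_mem_segment ..)
          (right_mem_segment ..)
    _ ≤ ε * ‖δ - γ‖ := by gcongr; exact (δ - γ).norm_coe_le_norm k

theorem fderiv_postcomp {f : C(E, F)} (hf : ContDiff ℝ 1 f) (γ : C(K, E)) :
    fderiv ℝ (fun γ : C(K, E) => f.comp γ) γ =
      pointwiseApply K E F
        ((⟨fderiv ℝ f, hf.continuous_fderiv one_ne_zero⟩ : C(E, E →L[ℝ] F)).comp γ) :=
  (hasFDerivAt_postcomp
    (fun y => (hf.differentiable one_ne_zero y).hasFDerivAt) γ).fderiv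

theorem contDiff_nat_postcomp (n : ℕ) : ∀ {F : Type (max u v)} [NormedAddCommGroup F]
    [NormedSpace ℝ F] {f : C(E, F)}, ContDiff ℝ n f →
      ContDiff ℝ n (fun γ : C(K, E) => f.comp γ) := by
  induction n with
  | zero => exact fun _ => contDiff_zero.2 (ContinuousMap.continuous_postcomp _)
  | succ n ih =>
    intro F _ _ f hf
    rw [Nat.cast_add, Nat.cast_one] at hf ⊢
    have hf1 : ContDiff ℝ 1 f := hf.of_le le_add_self
    refine contDiff_succ_iff_fderiv.2 ⟨fun γ => (hasFDerivAt_postcomp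
      (f' := ⟨fderiv ℝ f, hf1.continuous_fderiv one_ne_zero⟩)
      (fun y => (hf1.differentiable one_ne_zero y).hasFDerivAt) γ).differentiableAt, by simp, ?_⟩
    rw [funext (fderiv_postcomp hf1)]
    exact (pointwiseApply K E F).contDiff.comp
      (ih (f := ⟨fderiv ℝ f, _⟩) (contDiff_succ_iff_fderiv.1 hf).2.2)

theorem contDiff_postcomp {f : C(E, F)} (hf : ContDiff ℝ ∞ f) :
    ContDiff ℝ ∞ (fun γ : C(K, E) => f.comp γ) :=
  contDiff_infty.2 fun n => contDiff_nat_postcomp.{u, v} n (contDiff_infty.1 hf n)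

end Postcomposition

section Primitive

variable (F : Type*) [NormedAddCommGroup F] [NormedSpace ℝ F]

/-- The Volterra operator `γ ↦ (θ ↦ ∫ s in 0..θ, γ s)` on curves over the unit interval. -/
noncomputable def primitive : C(unitInterval, F) →L[ℝ] C(unitInterval, F) :=
  LinearMap.mkContinuous
    { toFun := fun γ => ⟨fun θ => ∫ s in (0 : ℝ)..θ, IccExtend zero_le_one γ s,
        (intervalIntegral.continuous_primitive
          (fun _ _ => γ.continuous.Icc_extend'.intervalIntegrable _ _) 0).comp
            continuous_subtype_val⟩
      map_add' := fun γ δ => by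
        ext θ
        exact intervalIntegral.integral_add (γ.continuous.Icc_extend'.intervalIntegrable _ _)
          (δ.continuous.Icc_extend'.intervalIntegrable _ _)
      map_smul' := fun c γ => by
        ext θ
        exact intervalIntegral.integral_smul c _ } 1 fun γ => by
    refine (ContinuousMap.norm_le _ (by positivity)).2 fun θ => ?_
    refine (intervalIntegral.norm_integral_le_of_norm_le_const
      fun s _ => γ.norm_coe_le_norm _).trans ?_
    rw [sub_zero, abs_of_nonneg θ.2.1, one_mul]
    exact mul_le_of_le_one_right (norm_nonneg _) θ.2.2

variable {F}

theorem primitive_apply (γ : C(unitInterval, F)) (θ : unitInterval) :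
    primitive F γ θ = ∫ s in (0 : ℝ)..θ, IccExtend zero_le_one γ s := rfl

theorem hasDerivWithinAt_primitive [CompleteSpace F] (γ : C(unitInterval, F)) (θ : unitInterval) :
    HasDerivWithinAt (IccExtend zero_le_one (primitive F γ)) (γ θ) (Icc 0 1) θ := by
  have hγ : Continuous (IccExtend zero_le_one γ) := γ.continuous.Icc_extend'
  have hderiv : HasDerivAt (fun s => ∫ r in (0 : ℝ)..s, IccExtend zero_le_one γ r)
      (IccExtend zero_le_one γ θ) θ :=
    intervalIntegral.integral_hasDerivAt_right (hγ.intervalIntegrable _ _)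
      (hγ.stronglyMeasurableAtFilter _ _) hγ.continuousAt
  rw [IccExtend_val] at hderiv
  exact hderiv.hasDerivWithinAt.congr_of_mem (fun s hs => IccExtend_of_mem _ _ hs) θ.2

end Primitive

section Hadamard

universe u v

variable {E : Type u} [NormedAddCommGroup E] [NormedSpace ℝ E]

theorem contDiff_integral_smul {F : Type (max u v)} [NormedAddCommGroup F] [NormedSpace ℝ F]
    {g : E → F} (hg : ContDiff ℝ ∞ g) : ContDiff ℝ ∞ fun y => ∫ s in (0 : ℝ)..1, g (s • y) := by
  let ray : E →L[ℝ] C(unitInterval, E) :=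
    pointwiseApply unitInterval E E ⟨fun s => (s : ℝ) • .id ℝ E, by fun_prop⟩ ∘L
      ContinuousLinearMap.const ℝ unitInterval
  let g' : C(E, F) := ⟨g, hg.continuous⟩
  have hray : ContDiff ℝ ∞ fun y => primitive F (g'.comp (ray y)) 1 :=
    (ContinuousMap.evalCLM ℝ (M := F) (1 : unitInterval)).contDiff.comp
      ((primitive F).contDiff.comp ((contDiff_postcomp.{u, v} (f := g') hg).comp ray.contDiff))
  have hint : ∀ y, ∫ s in (0 : ℝ)..1, g (s • y) = primitive F (g'.comp (ray y)) 1 := fun y =>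
    intervalIntegral.integral_congr fun s hs => by
      rw [uIcc_of_le zero_le_one] at hs
      exact (IccExtend_of_mem zero_le_one (g'.comp (ray y)) hs).symm
  simpa only [hint] using hray

/-- **Hadamard's lemma** -/
theorem exists_contDiff_eq_add_apply_sub {g : E → ℝ} (hg : ContDiff ℝ ∞ g) (a : E) :
    ∃ h : E → E →L[ℝ] ℝ, ContDiff ℝ ∞ h ∧ h a = fderiv ℝ g a ∧
      ∀ y, g y = g a + h y (y - a) := by
  have hg' : ContDiff ℝ ∞ fun z => fderiv ℝ g (a + z) :=
    (contDiff_infty_iff_fderiv.1 hg).2.comp (contDiff_const.add contDiff_id)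
  refine ⟨fun y => ∫ s in (0 : ℝ)..1, fderiv ℝ g (a + s • (y - a)),
    (contDiff_integral_smul hg').comp (contDiff_id.sub contDiff_const), by simp, fun y => ?_⟩
  have hderiv : ∀ s : ℝ, HasDerivAt (fun s : ℝ => g (a + s • (y - a)))
      (fderiv ℝ g (a + s • (y - a)) (y - a)) s := fun s =>
    (hg.differentiable (by simp) _).hasFDerivAt.comp_hasDerivAt s
      (by simpa using ((hasDerivAt_id s).smul_const (y - a)).const_add a)
  have hcont : Continuous fun s : ℝ => fderiv ℝ g (a + s • (y - a)) :=
    hg'.continuous.comp (by fun_prop)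
  rw [ContinuousLinearMap.intervalIntegral_apply (hcont.intervalIntegrable _ _),
    intervalIntegral.integral_eq_sub_of_hasDerivAt (fun s _ => hderiv s)
      ((hcont.clm_apply continuous_const).intervalIntegrable _ _)]
  simp

end Hadamard

section Volterra

variable {E : Type*} [NormedAddCommGroup E] [NormedSpace ℝ E]

theorem norm_primitive_pointwiseApply_pow_le (A : C(unitInterval, E →L[ℝ] E)) (n : ℕ)
    (δ : C(unitInterval, E)) (θ : unitInterval) :
    ‖((primitive E ∘L pointwiseApply unitInterval E E A) ^ n) δ θ‖ ≤
      (‖A‖ * θ) ^ n / n.factorial * ‖δ‖ := by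
  induction n generalizing θ with
  | zero => simpa using δ.norm_coe_le_norm θ
  | succ n ih =>
    set δn := ((primitive E ∘L pointwiseApply unitInterval E E A) ^ n) δ
    have hle : ∀ s ∈ Ioc (0 : ℝ) θ,
        ‖IccExtend zero_le_one (pointwiseApply unitInterval E E A δn) s‖ ≤
          ‖A‖ ^ (n + 1) / n.factorial * ‖δ‖ * s ^ n := by
      intro s hs
      have hs' : s ∈ Icc (0 : ℝ) 1 := ⟨hs.1.le, hs.2.trans θ.2.2⟩
      rw [IccExtend_of_mem _ _ hs']
      refine ((A _).le_of_opNorm_le_of_le (A.norm_coe_le_norm _) (ih ⟨s, hs'⟩)).trans_eq ?_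
      ring
    rw [pow_succ', mul_apply_eq_comp, ContinuousLinearMap.comp_apply, primitive_apply]
    refine (intervalIntegral.norm_integral_le_of_norm_le θ.2.1 (.of_forall hle)
      (Continuous.intervalIntegrable (by fun_prop) _ _)).trans_eq ?_
    rw [intervalIntegral.integral_const_mul, integral_pow, Nat.factorial_succ]
    push_cast
    field_simp
    ring

theorem isUnit_one_sub_of_norm_pow_lt_one {R : Type*} [NormedRing R] [HasSummableGeomSeries R]
    {x : R} {n : ℕ} (h : ‖x ^ n‖ < 1) : IsUnit (1 - x) := by
  have hcomm : Commute (1 - x) (∑ i ∈ Finset.range n, x ^ i) :=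
    (mul_neg_geom_sum x n).trans (geom_sum_mul_neg x n).symm
  have hunit : IsUnit (1 - x ^ n) := isUnit_one_sub_of_norm_lt_one h
  rw [← mul_neg_geom_sum, hcomm.isUnit_mul_iff] at hunit
  exact hunit.1

theorem isUnit_one_sub_primitive_pointwiseApply [CompleteSpace E]
    (A : C(unitInterval, E →L[ℝ] E)) :
    IsUnit (1 - primitive E ∘L pointwiseApply unitInterval E E A) := by
  set V := primitive E ∘L pointwiseApply unitInterval E E A
  obtain ⟨n, hn⟩ : ∃ n : ℕ, ‖A‖ ^ n / n.factorial < 1 :=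
    ((FloorSemiring.tendsto_pow_div_factorial_atTop ‖A‖).eventually_lt_const one_pos).exists
  have hVn : ‖V ^ n‖ < 1 := by
    refine (ContinuousLinearMap.opNorm_le_bound _ (by positivity) fun δ => ?_).trans_lt hn
    refine (ContinuousMap.norm_le _ (by positivity)).2 fun θ => ?_
    refine (norm_primitive_pointwiseApply_pow_le A n δ θ).trans ?_
    gcongr
    exacts [mul_nonneg (norm_nonneg A) θ.2.1, mul_le_of_le_one_right (norm_nonneg A) θ.2.2]
  exact isUnit_one_sub_of_norm_pow_lt_one (R := C(unitInterval, E) →L[ℝ] C(unitInterval, E)) hVn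

end Volterra

section Uniqueness

variable {E : Type*} [NormedAddCommGroup E] [NormedSpace ℝ E]

theorem eqOn_Icc_of_solve_locally {u w : ℝ → E} {a b : ℝ} (hu : ContinuousOn u (Icc a b))
    (hw : ContinuousOn w (Icc a b)) (ha : u a = w a)
    (h : ∀ s ∈ Ico a b, u s = w s → ∃ X : E → E, ContDiffAt ℝ 1 X (u s) ∧
      ∀ᶠ r in 𝓝[≥] s, HasDerivWithinAt u (X (u r)) (Ici r) r ∧
        HasDerivWithinAt w (X (w r)) (Ici r) r) :
    EqOn u w (Icc a b) := by
  have hclosed : IsClosed ({s | u s = w s} ∩ Icc a b) := by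
    rw [inter_comm]
    exact (hu.prodMk hw).preimage_isClosed_of_isClosed isClosed_Icc isClosed_diagonal
  refine fun s hs => hclosed.Icc_subset_of_forall_mem_nhdsWithin ha ?_ hs
  rintro s ⟨heq : u s = w s, hs⟩
  obtain ⟨X, hX, hderiv⟩ := h s hs heq
  obtain ⟨K, N, hN, hK⟩ := hX.exists_lipschitzOnWith
  have hIcc : 𝓝[≥] s ≤ 𝓝[Icc a b] s :=
    nhdsWithin_Icc_eq_nhdsGE hs.2 ▸ nhdsWithin_mono _ (Icc_subset_Icc_left hs.1)
  have huN : ∀ᶠ r in 𝓝[≥] s, u r ∈ N := hIcc (hu s (Ico_subset_Icc_self hs) hN)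
  have hwN : ∀ᶠ r in 𝓝[≥] s, w r ∈ N := hIcc (hw s (Ico_subset_Icc_self hs) (heq ▸ hN))
  obtain ⟨c, hsc, hc⟩ := mem_nhdsGE_iff_exists_Icc_subset.1
    (hderiv.and (huN.and (hwN.and (hIcc self_mem_nhdsWithin))))
  have hcab : Icc s c ⊆ Icc a b := fun r hr => (hc hr).2.2.2
  refine mem_of_superset (Icc_mem_nhdsGT hsc) <| ODE_solution_unique_of_mem_Icc_right
    (v := fun _ => X) (s := fun _ => N) (fun _ _ => hK)
    (hu.mono hcab) ?_ ?_ (hw.mono hcab) ?_ ?_ heq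
  all_goals intro r hr
  exacts [(hc (Ico_subset_Icc_self hr)).1.1, (hc (Ico_subset_Icc_self hr)).2.1,
    (hc (Ico_subset_Icc_self hr)).1.2, (hc (Ico_subset_Icc_self hr)).2.2.1]

theorem eqOn_uIcc_of_solve_locally {u w : ℝ → E} {a b : ℝ} (hu : ContinuousOn u (uIcc a b))
    (hw : ContinuousOn w (uIcc a b)) (ha : u a = w a)
    (h : ∀ s ∈ uIcc a b, u s = w s → ∃ X : E → E, ContDiffAt ℝ 1 X (u s) ∧
      ∀ᶠ r in 𝓝[uIcc a b] s, HasDerivWithinAt u (X (u r)) (uIcc a b) r ∧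
        HasDerivWithinAt w (X (w r)) (uIcc a b) r) :
    EqOn u w (uIcc a b) := by
  let line : ℝ →ᵃ[ℝ] ℝ := AffineMap.lineMap a b
  have hline : line '' Icc 0 1 = uIcc a b := by rw [← segment_eq_image_lineMap, segment_eq_uIcc]
  have hmaps : MapsTo line (Icc 0 1) (uIcc a b) := mapsTo_iff_image_subset.2 hline.subset
  have hcont : Continuous line := AffineMap.lineMap_continuous
  have hscale : ∀ {g : ℝ → E} {g' : E} {r : ℝ}, r ∈ Ico (0 : ℝ) 1 →
      HasDerivWithinAt g g' (uIcc a b) (line r) →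
        HasDerivWithinAt (g ∘ line) ((b - a) • g') (Ici r) r := by
    intro g g' r hr hg
    refine (hg.scomp r AffineMap.hasDerivWithinAt_lineMap hmaps).mono_of_mem_nhdsWithin ?_
    exact mem_of_superset (Icc_mem_nhdsGE hr.2) (Icc_subset_Icc_left hr.1)
  rw [← hline, ← eqOn_comp_right_iff]
  refine eqOn_Icc_of_solve_locally (hu.comp hcont.continuousOn hmaps)
    (hw.comp hcont.continuousOn hmaps) (by simpa [line] using ha) fun s hs heq => ?_
  obtain ⟨X, hX, hderiv⟩ := h (line s) (hmaps (Ico_subset_Icc_self hs)) heq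
  refine ⟨fun y => (b - a) • X y, hX.const_smul _, ?_⟩
  have hIco : Ico s 1 ∈ 𝓝[≥] s := Ico_mem_nhdsGE hs.2
  have htendsto : Tendsto line (𝓝[≥] s) (𝓝[uIcc a b] (line s)) := by
    refine tendsto_nhdsWithin_iff.2 ⟨hcont.continuousAt.mono_left nhdsWithin_le_nhds, ?_⟩
    filter_upwards [hIco] with r hr using hmaps ⟨hs.1.trans hr.1, hr.2.le⟩
  filter_upwards [htendsto.eventually hderiv, hIco] with r hr hr1
  exact ⟨hscale ⟨hs.1.trans hr1.1, hr1.2⟩ hr.1, hscale ⟨hs.1.trans hr1.1, hr1.2⟩ hr.2⟩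

end Uniqueness

section GlobalFlow

variable {E : Type*} [NormedAddCommGroup E] [NormedSpace ℝ E]

/-- `Ψ` is the flow of the complete vector field `X` on the normed space `E`. -/
structure IsGlobalFlow (X : E → E) (Ψ : E × ℝ → E) : Prop where
  map_zero : ∀ y, Ψ (y, 0) = y
  hasDerivAt : ∀ y t, HasDerivAt (fun s => Ψ (y, s)) (X (Ψ (y, t))) t

/-- The integral equation `γ θ = y + t ∫ s in 0..θ, X (γ s)`, written as the vanishing of a
function of `((y, t), γ)`. Its solutions are the integral curves of `X` started at `y`, with the
time interval from `0` to `t` rescaled to the unit interval. -/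
noncomputable def picardDefect (X : C(E, E)) (u : (E × ℝ) × C(unitInterval, E)) :
    C(unitInterval, E) :=
  u.2 - .const unitInterval u.1.1 - u.1.2 • primitive E (X.comp u.2)

theorem contDiff_picardDefect {X : C(E, E)} (hX : ContDiff ℝ ∞ X) :
    ContDiff ℝ ∞ (picardDefect X) :=
  (contDiff_snd.sub ((ContinuousLinearMap.const ℝ unitInterval).contDiff.comp
    (contDiff_fst.comp contDiff_fst))).sub
    ((contDiff_snd.comp contDiff_fst).smul
      ((primitive E).contDiff.comp ((contDiff_postcomp hX).comp contDiff_snd)))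

theorem isInvertible_fderiv_picardDefect [CompleteSpace E] {X : C(E, E)} (hX : ContDiff ℝ ∞ X)
    (u : (E × ℝ) × C(unitInterval, E)) :
    (fderiv ℝ (picardDefect X) u ∘L .inr ℝ (E × ℝ) C(unitInterval, E)).IsInvertible := by
  obtain ⟨z, γ⟩ := u
  let X' : C(E, E →L[ℝ] E) := ⟨fderiv ℝ X, hX.continuous_fderiv (by simp)⟩
  let V := primitive E ∘L pointwiseApply unitInterval E E (z.2 • X'.comp γ)
  have htotal : HasFDerivAt (fun δ => picardDefect X (z, δ))
      (fderiv ℝ (picardDefect X) (z, γ) ∘L .inr ℝ (E × ℝ) C(unitInterval, E)) γ :=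
    ((contDiff_picardDefect hX).differentiable (by simp) _).hasFDerivAt.comp γ
      (hasFDerivAt_prodMk_right z γ)
  have hpartial : HasFDerivAt (fun δ => picardDefect X (z, δ)) (1 - V) γ := by
    have hpost := (primitive E).hasFDerivAt.comp γ (hasFDerivAt_postcomp (f := X) (f' := X')
      (fun y => (hX.differentiable (by simp) y).hasFDerivAt) γ)
    refine (((hasFDerivAt_id γ).sub_const (.const unitInterval z.1)).sub
      (hpost.const_smul z.2)).congr_fderiv ?_
    rw [← ContinuousLinearMap.comp_smul, ← map_smul]
    rfl
  obtain ⟨e, he⟩ := isUnit_one_sub_primitive_pointwiseApply (z.2 • X'.comp γ)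
  rw [htotal.unique hpartial]
  exact ⟨ContinuousLinearEquiv.ofUnit e, he⟩

theorem picardDefect_eq_zero_iff {X : C(E, E)} {z : E × ℝ} {γ : C(unitInterval, E)} :
    picardDefect X (z, γ) = 0 ↔
      γ = .const unitInterval z.1 + z.2 • primitive E (X.comp γ) := by
  rw [picardDefect, sub_sub, sub_eq_zero]

theorem hasDerivWithinAt_of_picardDefect_eq_zero [CompleteSpace E] {X : C(E, E)} {z : E × ℝ}
    {γ : C(unitInterval, E)} (hγ : picardDefect X (z, γ) = 0) (s : ℝ) (hs : s ∈ Icc (0 : ℝ) 1) :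
    HasDerivWithinAt (IccExtend zero_le_one γ) (z.2 • X (IccExtend zero_le_one γ s))
      (Icc 0 1) s := by
  have hγ' : IccExtend zero_le_one γ = fun r =>
      z.1 + z.2 • IccExtend zero_le_one (primitive E (X.comp γ)) r :=
    funext fun r => DFunLike.congr_fun (picardDefect_eq_zero_iff.1 hγ) (projIcc 0 1 zero_le_one r)
  have hderiv := ((hasDerivWithinAt_primitive (X.comp γ) ⟨s, hs⟩).const_smul z.2).const_add z.1
  rw [IccExtend_of_mem _ _ hs]
  exact hderiv.congr_of_mem (fun r _ => congrFun hγ' r) hs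

namespace IsGlobalFlow

variable {X : E → E} {Ψ : E × ℝ → E}

theorem hasDerivAt_mul (hΨ : IsGlobalFlow X Ψ) (y : E) (t s : ℝ) :
    HasDerivAt (fun r => Ψ (y, t * r)) (t • X (Ψ (y, t * s))) s :=
  (hΨ.hasDerivAt y (t * s)).scomp s (by simpa using (hasDerivAt_id s).const_mul t)

/-- The trajectory of `z.1` over the time interval from `0` to `z.2`, rescaled to the unit
interval. -/
def curve (hΨ : IsGlobalFlow X Ψ) (z : E × ℝ) : C(unitInterval, E) where
  toFun θ := Ψ (z.1, z.2 * θ)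
  continuous_toFun := (continuous_iff_continuousAt.2 fun s =>
    (hΨ.hasDerivAt_mul z.1 z.2 s).continuousAt).comp continuous_subtype_val

theorem picardDefect_curve [CompleteSpace E] (hΨ : IsGlobalFlow X Ψ) (hX : Continuous X)
    (z : E × ℝ) : picardDefect ⟨X, hX⟩ (z, hΨ.curve z) = 0 := by
  rw [picardDefect_eq_zero_iff]
  ext θ
  have hcont : Continuous fun s : ℝ => Ψ (z.1, z.2 * s) :=
    continuous_iff_continuousAt.2 fun s => (hΨ.hasDerivAt_mul z.1 z.2 s).continuousAt
  have hftc : ∫ s in (0 : ℝ)..θ, z.2 • X (Ψ (z.1, z.2 * s)) = Ψ (z.1, z.2 * θ) - z.1 := by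
    rw [intervalIntegral.integral_eq_sub_of_hasDerivAt (fun s _ => hΨ.hasDerivAt_mul z.1 z.2 s)
      (((hX.comp hcont).const_smul z.2).intervalIntegrable _ _), mul_zero, hΨ.map_zero]
  have hprim : primitive E ((⟨X, hX⟩ : C(E, E)).comp (hΨ.curve z)) θ =
      ∫ s in (0 : ℝ)..θ, X (Ψ (z.1, z.2 * s)) :=
    intervalIntegral.integral_congr fun s hs => by
      rw [uIcc_of_le θ.2.1] at hs
      exact IccExtend_of_mem _ _ ⟨hs.1, hs.2.trans θ.2.2⟩
  rw [ContinuousMap.add_apply, ContinuousMap.smul_apply, hprim, ← intervalIntegral.integral_smul,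
    hftc]
  exact (add_sub_cancel z.1 _).symm

theorem eq_curve_of_picardDefect_eq_zero [CompleteSpace E] (hΨ : IsGlobalFlow X Ψ)
    (hX : ContDiff ℝ 1 X) {z : E × ℝ} {γ : C(unitInterval, E)}
    (hγ : picardDefect ⟨X, hX.continuous⟩ (z, γ) = 0) : γ = hΨ.curve z := by
  have heq : EqOn (IccExtend zero_le_one γ) (fun s => Ψ (z.1, z.2 * s)) (uIcc 0 1) := by
    refine eqOn_uIcc_of_solve_locally γ.continuous.Icc_extend'.continuousOn
      (fun s _ => (hΨ.hasDerivAt_mul z.1 z.2 s).continuousAt.continuousWithinAt) ?_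
      fun s hs _ => ⟨fun y => z.2 • X y, hX.contDiffAt.const_smul _, ?_⟩
    · have h0 : γ 0 = z.1 := by
        rw [picardDefect_eq_zero_iff.1 hγ]
        simp [primitive_apply]
      simp [hΨ.map_zero, h0]
    · rw [uIcc_of_le zero_le_one] at hs ⊢
      filter_upwards [self_mem_nhdsWithin] with r hr
      exact ⟨hasDerivWithinAt_of_picardDefect_eq_zero hγ r hr,
        (hΨ.hasDerivAt_mul z.1 z.2 r).hasDerivWithinAt⟩
  ext θ
  rw [uIcc_of_le zero_le_one] at heq
  exact (IccExtend_val zero_le_one γ θ).symm.trans (heq θ.2)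

theorem contDiff [CompleteSpace E] (hΨ : IsGlobalFlow X Ψ) (hX : ContDiff ℝ ∞ X) :
    ContDiff ℝ ∞ Ψ := by
  have hdefect := contDiff_picardDefect (X := ⟨X, hX.continuous⟩) hX
  have hcurve : ContDiff ℝ ∞ hΨ.curve := contDiff_iff_contDiffAt.2 fun z => by
    have hinv := isInvertible_fderiv_picardDefect (X := ⟨X, hX.continuous⟩) hX (z, hΨ.curve z)
    refine (hdefect.contDiffAt.contDiffAt_implicitFunction (by simp) hinv).congr_of_eventuallyEq ?_
    filter_upwards [hdefect.contDiffAt.eventually_apply_implicitFunction (by simp) hinv]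
      with z' hz'
    exact (hΨ.eq_curve_of_picardDefect_eq_zero (hX.of_le (by simp))
      (hz'.trans (hΨ.picardDefect_curve hX.continuous z))).symm
  have heval : ContDiff ℝ ∞ fun z => hΨ.curve z 1 :=
    (ContinuousMap.evalCLM ℝ (M := E) (1 : unitInterval)).contDiff.comp hcurve
  simpa [curve] using heval

end IsGlobalFlow

theorem exists_hasDerivAt_of_abs_lt [CompleteSpace E] {X : E → E} {K C : ℝ≥0}
    (hX : LipschitzWith K X) (hC : ∀ y, ‖X y‖ ≤ C) (y : E) {T : ℝ} (hT : 0 < T) :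
    ∃ α : ℝ → E, α 0 = y ∧ ∀ t, |t| < T → HasDerivAt α (X (α t)) t := by
  have hpl : IsPicardLindelof (fun _ => X) (tmin := -T) (tmax := T) ⟨0, by simp [hT.le]⟩ y
      (C * ⟨T, hT.le⟩) 0 C K :=
    .of_time_independent (fun y _ => hC y) hX.lipschitzOnWith (by simp; rfl)
  obtain ⟨α, hα0, hα⟩ := hpl.exists_eq_forall_mem_Icc_hasDerivWithinAt₀
  refine ⟨α, hα0, fun t ht => ?_⟩
  rw [abs_lt] at ht
  exact (hα t ⟨ht.1.le, ht.2.le⟩).hasDerivAt (Icc_mem_nhds ht.1 ht.2)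

theorem exists_isGlobalFlow [CompleteSpace E] {X : E → E} {K C : ℝ≥0} (hX : LipschitzWith K X)
    (hC : ∀ y, ‖X y‖ ≤ C) : ∃ Ψ, IsGlobalFlow X Ψ := by
  have hpos : ∀ t : ℝ, 0 < |t| + 1 := fun t => by positivity
  choose α hα0 hα using fun (y : E) (t : ℝ) => exists_hasDerivAt_of_abs_lt hX hC y (hpos t)
  have hagree : ∀ y t s, |s| < |t| + 1 → α y s s = α y t s := by
    intro y t s hs
    have hs' : |s| < min (|s| + 1) (|t| + 1) := lt_min (by linarith) hs
    refine ODE_solution_unique_of_mem_Ioo (v := fun _ => X) (s := fun _ => univ)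
      (fun _ _ => hX.lipschitzOnWith) (t₀ := 0)
      (abs_lt.1 ?_)
      (fun r hr => ⟨hα y s r ?_, mem_univ _⟩) (fun r hr => ⟨hα y t r ?_, mem_univ _⟩)
      ((hα0 y s).trans (hα0 y t).symm) (abs_lt.1 hs')
    exacts [abs_zero.trans_lt ((abs_nonneg s).trans_lt hs'),
      (abs_lt.2 hr).trans_le (min_le_left _ _), (abs_lt.2 hr).trans_le (min_le_right _ _)]
  refine ⟨fun z => α z.1 z.2 z.2, fun y => hα0 y 0, fun y t => ?_⟩
  refine (hα y t t (lt_add_one _)).congr_of_eventuallyEq ?_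
  filter_upwards [continuous_abs.continuousAt.eventually_lt_const (lt_add_one |t|)] with s hs
    using hagree y t s hs

theorem exists_isGlobalFlow_of_hasCompactSupport [FiniteDimensional ℝ E] {X : E → E}
    (hX : ContDiff ℝ 1 X) (hsupp : HasCompactSupport X) : ∃ Ψ, IsGlobalFlow X Ψ := by
  have := FiniteDimensional.complete ℝ E
  obtain ⟨K, hK⟩ := hX.lipschitzWith_of_hasCompactSupport hsupp one_ne_zero
  obtain ⟨C, hC⟩ := hsupp.exists_bound_of_continuous hX.continuous
  exact exists_isGlobalFlow hK fun y => (hC y).trans (Real.le_coe_toNNReal C)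

end GlobalFlow

theorem exists_contDiff_hasCompactSupport_eventually_mem {E F : Type*} [NormedAddCommGroup E]
    [NormedSpace ℝ E] [FiniteDimensional ℝ E] [NormedAddCommGroup F] [NormedSpace ℝ F]
    {n : ℕ∞} {K : Set E} (hK : IsCompact K) {A : E → Set F} (hA : ∀ y, Convex ℝ (A y))
    (hloc : ∀ y ∈ K, ∃ g : E → F, ContDiff ℝ n g ∧ ∀ᶠ z in 𝓝 y, g z ∈ A z) :
    ∃ X : E → F, ContDiff ℝ n X ∧ HasCompactSupport X ∧ ∀ᶠ z in 𝓝ˢ K, X z ∈ A z := by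
  have hopen : IsOpen {y | ∃ g : E → F, ContDiff ℝ n g ∧ ∀ᶠ z in 𝓝 y, g z ∈ A z} :=
    isOpen_iff_eventually.2 fun y ⟨g, hg, h⟩ => h.eventually_nhds.mono fun _ hz => ⟨g, hg, hz⟩
  obtain ⟨L, hL, hKL, hLg⟩ := exists_compact_between hK hopen hloc
  obtain ⟨L', hL', hLL'⟩ := exists_compact_superset hL
  obtain ⟨X, hX⟩ := exists_contMDiffMap_forall_mem_convex_of_local (n := n) 𝓘(ℝ, E)
    (t := fun y => {w | (y ∈ L → w ∈ A y) ∧ (y ∉ L' → w = 0)})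
    (fun y w hw w' hw' a b ha hb hab =>
      ⟨fun hy => hA y (hw.1 hy) (hw'.1 hy) ha hb hab, fun hy => by simp [hw.2 hy, hw'.2 hy]⟩)
    fun y => by
      by_cases hy : y ∈ L
      · obtain ⟨g, hg, h⟩ := hLg hy
        exact ⟨_, inter_mem h (isOpen_interior.mem_nhds (hLL' hy)), g, hg.contMDiff.contMDiffOn,
          fun z hz => ⟨fun _ => hz.1, fun hz' => (hz' (interior_subset hz.2)).elim⟩⟩
      · exact ⟨_, hL.isClosed.isOpen_compl.mem_nhds hy, 0, contMDiffOn_const,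
          fun z hz => ⟨fun hz' => (hz hz').elim, fun _ => rfl⟩⟩
  exact ⟨X, X.contMDiff.contDiff, .intro hL' fun y hy => (hX y).2 hy,
    (eventually_nhdsSet_iff_forall.2 fun y hy => isOpen_interior.mem_nhds (hKL hy)).mono
      fun z hz => (hX z).1 (interior_subset hz)⟩

open DifferentialStructure

theorem eq_of_eventuallyEq_comap {α β γ : Type*} [TopologicalSpace β] {c : α → β} {f g : α → γ}
    {p : α} (h : f =ᶠ[comap c (𝓝 (c p))] g) : f p = g p :=
  (eventually_comap.1 h).self_of_nhds p rfl

section SmoothAlong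

variable {N N' E E' G : Type*} [NormedAddCommGroup E] [NormedSpace ℝ E]
  [NormedAddCommGroup E'] [NormedSpace ℝ E'] [NormedAddCommGroup G] [NormedSpace ℝ G]

/-- The map `f` is, near every point, a smooth function of `c`. Here nearness is measured by `c`,
so that no topology on the domain is involved. -/
def IsSmoothAlong (c : N → E) (f : N → G) : Prop :=
  ∀ p, ∃ g : E → G, ContDiff ℝ ∞ g ∧ f =ᶠ[comap c (𝓝 (c p))] g ∘ c

theorem isSmoothAlong_of_contDiff {g : E → G} (hg : ContDiff ℝ ∞ g) (c : N → E) :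
    IsSmoothAlong c (g ∘ c) :=
  fun _ => ⟨g, hg, .rfl⟩

namespace IsSmoothAlong

variable {c : N → E}

theorem tendsto {f : N → G} (hf : IsSmoothAlong c f) (p : N) :
    Tendsto f (comap c (𝓝 (c p))) (𝓝 (f p)) := by
  obtain ⟨g, hg, h⟩ := hf p
  rw [eq_of_eventuallyEq_comap h]
  exact ((hg.continuous.tendsto _).comp tendsto_comap).congr' h.symm

theorem comp {d : N' → E'} {f : N' → G} (hf : IsSmoothAlong d f) {φ : N → N'}
    (hφ : IsSmoothAlong c (d ∘ φ)) : IsSmoothAlong c (f ∘ φ) := by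
  intro p
  obtain ⟨k, hk, hφk⟩ := hφ p
  obtain ⟨g, hg, hfg⟩ := hf (φ p)
  refine ⟨g ∘ k, hg.comp hk, ?_⟩
  filter_upwards [hφk, (tendsto_comap_iff.2 (hφ.tendsto p)).eventually hfg] with q hq hq'
  simp only [Function.comp_apply] at hq hq' ⊢
  rw [hq', hq]

theorem contDiff_comp {f : N → E'} {g : E' → G} (hg : ContDiff ℝ ∞ g) (hf : IsSmoothAlong c f) :
    IsSmoothAlong c (g ∘ f) :=
  (isSmoothAlong_of_contDiff hg f).comp hf

theorem pi {ι : Type*} [Fintype ι] {f : ι → N → G} (hf : ∀ i, IsSmoothAlong c (f i)) :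
    IsSmoothAlong c fun q i => f i q := by
  intro p
  choose g hg h using fun i => hf i p
  exact ⟨fun y i => g i y, contDiff_pi.2 hg, (eventually_all.2 h).mono fun q hq => funext hq⟩

end IsSmoothAlong

theorem induced_le_initialTopology (c : N → E) :
    TopologicalSpace.induced c inferInstance ≤ initialTopology {f | IsSmoothAlong c f} := by
  let _ : TopologicalSpace N := .induced c inferInstance
  refine le_iInf₂ fun f hf =>
    continuous_iff_le_induced.1 (continuous_iff_continuousAt.2 fun p => ?_)
  rw [ContinuousAt, nhds_induced]
  exact IsSmoothAlong.tendsto hf p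

namespace DifferentialStructure

/-- The differential structure of the functions that are locally smooth functions of `c`. -/
def smoothAlong (c : N → E) : DifferentialStructure N where
  carrier := {f | IsSmoothAlong c f}
  nonempty := ⟨_, isSmoothAlong_of_contDiff (contDiff_const (c := (0 : ℝ))) c⟩
  comp_mem _ _ hg _ hf := IsSmoothAlong.contDiff_comp hg (.pi hf)
  local_mem f hf p := by
    obtain ⟨U, hU, a, ha, hfa⟩ := hf p
    obtain ⟨g, hg, hag⟩ := ha p
    have hU' : U ∈ comap c (𝓝 (c p)) :=
      nhds_induced c p ▸ nhds_mono (induced_le_initialTopology c) hU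
    exact ⟨g, hg, (eventuallyEq_of_mem hU' hfa).trans hag⟩

theorem subset_generate (A : Set (N → ℝ)) : A ⊆ (generate A).carrier :=
  fun _ hf _ hG => hG hf

theorem generate_subset {A : Set (N → ℝ)} {F : DifferentialStructure N} (h : A ⊆ F.carrier) :
    (generate A).carrier ⊆ F.carrier :=
  fun _ hf => hf F h

theorem restrict_mem_subspace {F : DifferentialStructure N} {f : N → ℝ} (hf : f ∈ F.carrier)
    (S : Set N) : (fun q : S => f q) ∈ (F.subspace S).carrier :=
  subset_generate _ ⟨f, hf, rfl⟩

theorem clm_comp_prodMap_mem {F : DifferentialStructure N} {F' : DifferentialStructure N'}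
    {x : N → E} {x' : N' → E'} (hx : ∀ l : E →L[ℝ] ℝ, l ∘ x ∈ F.carrier)
    (hx' : ∀ l : E' →L[ℝ] ℝ, l ∘ x' ∈ F'.carrier) (W : Set (N × N'))
    (l : E × E' →L[ℝ] ℝ) :
    l ∘ (fun w : W => Prod.map x x' w) ∈ ((F.prod F').subspace W).carrier := by
  have hfst : (fun z => l (x z.1, 0)) ∈ (F.prod F').carrier :=
    subset_generate _ (.inl ⟨_, hx (l.comp (.inl ℝ E E')), rfl⟩)
  have hsnd : (fun z => l (0, x' z.2)) ∈ (F.prod F').carrier :=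
    subset_generate _ (.inr ⟨_, hx' (l.comp (.inr ℝ E E')), rfl⟩)
  convert restrict_mem_subspace ((F.prod F').toSubalgebra.add_mem hfst hsnd) W using 2 with w
  simp [← map_add]
  rfl

variable [FiniteDimensional ℝ E]

theorem clm_mem_standard (l : E →L[ℝ] ℝ) : ⇑l ∈ (standard E).carrier := by
  change ContDiff ℝ ∞ l
  exact l.contDiff

variable {F : DifferentialStructure N} {c : N → E}

theorem contDiff_comp_mem (hc : ∀ l : E →L[ℝ] ℝ, l ∘ c ∈ F.carrier) {g : E → ℝ}
    (hg : ContDiff ℝ ∞ g) : g ∘ c ∈ F.carrier := by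
  let e : E ≃L[ℝ] (Fin (Module.finrank ℝ E) → ℝ) := .ofFinrankEq (by simp)
  have h := F.comp_mem _ (g ∘ e.symm) (hg.comp e.symm.contDiff) (fun i q => e (c q) i)
    fun i => hc ((ContinuousLinearMap.proj i).comp e.toContinuousLinearMap)
  simpa [Function.comp_def] using h

theorem initialTopology_le_induced (hc : ∀ l : E →L[ℝ] ℝ, l ∘ c ∈ F.carrier) :
    initialTopology F.carrier ≤ .induced c inferInstance := by
  let _ : TopologicalSpace N := initialTopology F.carrier
  let e : E ≃L[ℝ] (Fin (Module.finrank ℝ E) → ℝ) := .ofFinrankEq (by simp)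
  refine continuous_iff_le_induced.1 (e.toHomeomorph.comp_continuous_iff.1 ?_)
  exact continuous_pi fun i => continuous_iff_le_induced.2 <|
    iInf₂_le _ (hc ((ContinuousLinearMap.proj i).comp e.toContinuousLinearMap))

theorem mem_of_isSmoothAlong (hc : ∀ l : E →L[ℝ] ℝ, l ∘ c ∈ F.carrier) {f : N → ℝ}
    (hf : IsSmoothAlong c f) : f ∈ F.carrier := by
  refine F.local_mem f fun p => ?_
  obtain ⟨g, hg, h⟩ := hf p
  refine ⟨_, nhds_mono (initialTopology_le_induced hc) ?_, _, contDiff_comp_mem hc hg,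
    fun _ hq => hq⟩
  rwa [nhds_induced]

theorem mem_subspace_standard_iff {S : Set E} {f : S → ℝ} :
    f ∈ ((standard E).subspace S).carrier ↔ IsSmoothAlong Subtype.val f := by
  refine ⟨fun hf => generate_subset (F := smoothAlong Subtype.val) ?_ hf,
    mem_of_isSmoothAlong fun l => ?_⟩
  · rintro _ ⟨g, hg, rfl⟩
    exact isSmoothAlong_of_contDiff hg _
  · exact restrict_mem_subspace (clm_mem_standard l) S

end DifferentialStructure

end SmoothAlong

/-- The coordinate functionals of a finite-dimensional space with respect to the basis
`Module.finBasis ℝ E`. -/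
noncomputable def coordinate (E : Type*) [NormedAddCommGroup E] [NormedSpace ℝ E]
    [FiniteDimensional ℝ E] (i : Fin (Module.finrank ℝ E)) : E →L[ℝ] ℝ :=
  ((Module.finBasis ℝ E).coord i).toContinuousLinearMap

theorem sum_coordinate_smul {E : Type*} [NormedAddCommGroup E] [NormedSpace ℝ E]
    [FiniteDimensional ℝ E] (y : E) :
    ∑ i, coordinate E i y • Module.finBasis ℝ E i = y :=
  (Module.finBasis ℝ E).sum_repr y

/-- The functions of the differential structure are those that are locally smooth functions of the
injective map `x`; that is, `x` is a diffeomorphism onto its image in `E`. -/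
structure IsSmoothEmbedding {M E : Type*} [NormedAddCommGroup E] [NormedSpace ℝ E]
    (F : DifferentialStructure M) (x : M → E) : Prop where
  injective : Function.Injective x
  mem_iff : ∀ f, f ∈ F.carrier ↔ IsSmoothAlong x f

section Embedding

variable {M E : Type*} [NormedAddCommGroup E] [NormedSpace ℝ E] {F : DifferentialStructure M}

theorem Diffeomorphic.exists_isSmoothEmbedding [FiniteDimensional ℝ E] {S : Set E}
    (h : Diffeomorphic F ((standard E).subspace S)) : ∃ x : M → E, IsSmoothEmbedding F x := by
  obtain ⟨e, he, he'⟩ := h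
  refine ⟨Subtype.val ∘ e, Subtype.val_injective.comp e.injective, fun f => ⟨fun hf => ?_,
    mem_of_isSmoothAlong fun l => ?_⟩⟩
  · have hfe : IsSmoothAlong Subtype.val (f ∘ e.symm) := mem_subspace_standard_iff.1 (he' f hf)
    have := hfe.comp (isSmoothAlong_of_contDiff contDiff_id (Subtype.val ∘ e))
    simpa [Function.comp_assoc] using this
  · exact he _ (restrict_mem_subspace (clm_mem_standard l) S)

namespace IsSmoothEmbedding

variable {x : M → E}

theorem contDiff_comp_mem (hx : IsSmoothEmbedding F x) {g : E → ℝ} (hg : ContDiff ℝ ∞ g) :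
    g ∘ x ∈ F.carrier :=
  (hx.mem_iff _).2 (isSmoothAlong_of_contDiff hg x)

theorem isSmooth (hx : IsSmoothEmbedding F x) {N E' : Type*} [NormedAddCommGroup E']
    [NormedSpace ℝ E'] [FiniteDimensional ℝ E'] {G : DifferentialStructure N} {c : N → E'}
    (hc : ∀ l : E' →L[ℝ] ℝ, l ∘ c ∈ G.carrier) {φ : N → M} (hφ : IsSmoothAlong c (x ∘ φ)) :
    IsSmooth G F φ :=
  fun f hf => mem_of_isSmoothAlong hc (((hx.mem_iff f).1 hf).comp hφ)

/-- A smooth function of the embedding, as an element of the algebra on which derivations act. -/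
def pullback (hx : IsSmoothEmbedding F x) (g : E → ℝ) (hg : ContDiff ℝ ∞ g) : F.toSubalgebra :=
  ⟨g ∘ x, hx.contDiff_comp_mem hg⟩

variable [FiniteDimensional ℝ E] (v : Derivation ℝ F.toSubalgebra F.toSubalgebra)

theorem derivation_congr (hx : IsSmoothEmbedding F x) {a b : F.toSubalgebra} {p : M}
    (h : (a : M → ℝ) =ᶠ[comap x (𝓝 (x p))] b) : (v a : M → ℝ) p = (v b : M → ℝ) p := by
  have hp := eq_of_eventuallyEq_comap h
  obtain ⟨U, hU, hUab⟩ := mem_comap.1 h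
  obtain ⟨χ, hχU, -, hχ, -, hχ1⟩ := exists_contDiff_tsupport_subset (n := ⊤) hU
  have hzero : hx.pullback χ hχ * (a - b) = 0 := by
    ext q
    change χ (x q) * ((a : M → ℝ) q - (b : M → ℝ) q) = 0
    by_cases hq : x q ∈ U
    · rw [show (a : M → ℝ) q = (b : M → ℝ) q from hUab hq, sub_self, mul_zero]
    · rw [image_eq_zero_of_notMem_tsupport (mt (@hχU _) hq), zero_mul]
  have hleibniz : χ (x p) * ((v a : M → ℝ) p - (v b : M → ℝ) p) +
      ((a : M → ℝ) p - (b : M → ℝ) p) * (v (hx.pullback χ hχ) : M → ℝ) p = 0 := by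
    have := congrArg v hzero
    rw [Derivation.leibniz, map_zero, map_sub] at this
    exact congrArg (fun f : F.toSubalgebra => (f : M → ℝ) p) this
  rw [hp, sub_self, zero_mul, add_zero, hχ1, one_mul] at hleibniz
  exact sub_eq_zero.1 hleibniz

variable (hx : IsSmoothEmbedding F x)

/-- The vector field along the embedding that represents a derivation. -/
noncomputable def vectorField (p : M) : E :=
  ∑ i, (v (hx.pullback (coordinate E i) (coordinate E i).contDiff) : M → ℝ) p •
    Module.finBasis ℝ E i

/-- By Hadamard's lemma, a smooth function of `x` is a combination of the coordinate functions. -/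
theorem derivation_pullback {g : E → ℝ} (hg : ContDiff ℝ ∞ g) (p : M) :
    (v (hx.pullback g hg) : M → ℝ) p = fderiv ℝ g (x p) (hx.vectorField v p) := by
  obtain ⟨h, hh, hhp, hgh⟩ := exists_contDiff_eq_add_apply_sub hg (x p)
  have hbasis : ∀ i, ContDiff ℝ ∞ fun y => h y (Module.finBasis ℝ E i) := fun i =>
    hh.clm_apply contDiff_const
  let X i : F.toSubalgebra := hx.pullback (coordinate E i) (coordinate E i).contDiff
  let H i : F.toSubalgebra := hx.pullback _ (hbasis i)
  have hdecomp : hx.pullback g hg = algebraMap ℝ _ (g (x p)) +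
      ∑ i, (X i - algebraMap ℝ _ (coordinate E i (x p))) * H i := by
    ext q
    change g (x q) = _
    rw [hgh (x q), ← sum_coordinate_smul (x q - x p)]
    simp [X, H, pullback, Algebra.algebraMap_eq_smul_one]
  rw [hdecomp, ← hhp]
  simp only [map_add, map_sum, map_sub, Derivation.leibniz, Derivation.map_algebraMap]
  simp [X, H, pullback, vectorField, Algebra.algebraMap_eq_smul_one, mul_comm]

theorem derivation_apply {f : F.toSubalgebra} {g : E → ℝ} (hg : ContDiff ℝ ∞ g) {p : M}
    (h : (f : M → ℝ) =ᶠ[comap x (𝓝 (x p))] g ∘ x) :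
    (v f : M → ℝ) p = fderiv ℝ g (x p) (hx.vectorField v p) :=
  (hx.derivation_congr v (b := hx.pullback g hg) h).trans (hx.derivation_pullback v hg p)

theorem isSmoothAlong_vectorField : IsSmoothAlong x (hx.vectorField v) :=
  IsSmoothAlong.contDiff_comp
    (g := fun w : Fin (Module.finrank ℝ E) → ℝ => ∑ i, w i • Module.finBasis ℝ E i) (by fun_prop)
    (.pi fun _ => (hx.mem_iff _).1 (v _).2)

end IsSmoothEmbedding

end Embedding

section Trajectory

variable {M E : Type*} [NormedAddCommGroup E] [NormedSpace ℝ E]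

/-- `γ` is a solution of `(x ∘ γ)' = b ∘ γ` between the times `0` and `t` that starts at `p`: an
integral curve of the vector field `b` along the map `x`. Values of `γ` at other times are
irrelevant. -/
structure IsTrajectory (x b : M → E) (p : M) (t : ℝ) (γ : ℝ → M) : Prop where
  map_zero : γ 0 = p
  hasDerivWithinAt : ∀ s ∈ uIcc 0 t, HasDerivWithinAt (x ∘ γ) (b (γ s)) (uIcc 0 t) s

variable {x b : M → E} {p : M} {t : ℝ} {γ : ℝ → M}

namespace IsTrajectory

theorem const (x b : M → E) (p : M) : IsTrajectory x b p 0 fun _ => p :=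
  ⟨rfl, fun _ _ => hasDerivWithinAt_iff_hasFDerivWithinAt.2 <|
    .of_subsingleton (by simp only [uIcc_self, subsingleton_singleton])⟩

theorem mono (h : IsTrajectory x b p t γ) {s : ℝ} (hs : s ∈ uIcc 0 t) :
    IsTrajectory x b p s γ :=
  have hsub := uIcc_subset_uIcc_left hs
  ⟨h.map_zero, fun r hr => (h.hasDerivWithinAt r (hsub hr)).mono hsub⟩

theorem continuousOn (h : IsTrajectory x b p t γ) : ContinuousOn (x ∘ γ) (uIcc 0 t) :=
  fun s hs => (h.hasDerivWithinAt s hs).continuousWithinAt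

theorem eventually_hasDerivWithinAt (h : IsTrajectory x b p t γ) {X : E → E} {s : ℝ}
    (hs : s ∈ uIcc 0 t) (hX : b =ᶠ[comap x (𝓝 (x (γ s)))] X ∘ x) :
    ∀ᶠ r in 𝓝[uIcc 0 t] s, HasDerivWithinAt (x ∘ γ) (X (x (γ r))) (uIcc 0 t) r := by
  have hγ : Tendsto γ (𝓝[uIcc 0 t] s) (comap x (𝓝 (x (γ s)))) :=
    tendsto_comap_iff.2 (h.continuousOn s hs)
  filter_upwards [hγ.eventually hX, self_mem_nhdsWithin] with r hr hrt
  exact (show b (γ r) = X (x (γ r)) from hr) ▸ h.hasDerivWithinAt r hrt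

theorem eqOn {γ' : ℝ → M} (hx : Function.Injective x) (hb : IsSmoothAlong x b)
    (h : IsTrajectory x b p t γ) (h' : IsTrajectory x b p t γ') : EqOn γ γ' (uIcc 0 t) := by
  refine EqOn.cancel_left (eqOn_uIcc_of_solve_locally h.continuousOn h'.continuousOn
    (by simp [h.map_zero, h'.map_zero]) fun s hs heq => ?_) hx.injOn (mapsTo_univ _ _)
    (mapsTo_univ _ _)
  obtain ⟨X, hX, hbX⟩ := hb (γ s)
  exact ⟨X, (hX.of_le (by simp)).contDiffAt, (h.eventually_hasDerivWithinAt hs hbX).and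
    (h'.eventually_hasDerivWithinAt hs ((show x (γ s) = x (γ' s) from heq) ▸ hbX))⟩

theorem eqOn_globalFlow {X : E → E} {Ψ : E × ℝ → E} (hX : ContDiff ℝ 1 X)
    (hΨ : IsGlobalFlow X Ψ) (h : IsTrajectory x b p t γ)
    (hbX : ∀ s ∈ uIcc 0 t, x (γ s) = Ψ (x p, s) → b =ᶠ[comap x (𝓝 (Ψ (x p, s)))] X ∘ x) :
    EqOn (x ∘ γ) (fun s => Ψ (x p, s)) (uIcc 0 t) := by
  refine eqOn_uIcc_of_solve_locally h.continuousOn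
    (fun s _ => (hΨ.hasDerivAt _ s).continuousAt.continuousWithinAt)
    (by simp [h.map_zero, hΨ.map_zero]) fun s hs heq => ⟨X, hX.contDiffAt, ?_⟩
  have hγ := h.eventually_hasDerivWithinAt hs
    ((show x (γ s) = Ψ (x p, s) from heq) ▸ hbX s hs heq)
  exact hγ.mono fun r hr => ⟨hr, (hΨ.hasDerivAt _ r).hasDerivWithinAt⟩

/-- Along the compact image of the trajectory, local extensions of `b` to vector fields on `E` are
glued by a partition of unity; extending `b` is a convex condition. -/
theorem exists_isGlobalFlow [FiniteDimensional ℝ E] (hb : IsSmoothAlong x b)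
    (h : IsTrajectory x b p t γ) : ∃ X Ψ, ContDiff ℝ ∞ X ∧ IsGlobalFlow X Ψ ∧
      ∀ s ∈ uIcc 0 t, b =ᶠ[comap x (𝓝 (Ψ (x p, s)))] X ∘ x := by
  obtain ⟨X, hX, hsupp, hXb⟩ := exists_contDiff_hasCompactSupport_eventually_mem (n := ⊤)
    (isCompact_uIcc.image_of_continuousOn h.continuousOn)
    (A := fun y => {w | ∀ q, x q = y → b q = w})
    (fun y w hw w' hw' a a' _ _ haa' q hq => by
      rw [← hw q hq, ← hw' q hq, ← add_smul, haa', one_smul])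
    (by
      rintro _ ⟨s, -, rfl⟩
      obtain ⟨g, hg, hbg⟩ := hb (γ s)
      exact ⟨g, hg, (eventually_comap.1 hbg).mono fun z hz q hq => (hz q hq).trans (congrArg g hq)⟩)
  obtain ⟨Ψ, hΨ⟩ := exists_isGlobalFlow_of_hasCompactSupport (hX.of_le (by simp)) hsupp
  have hbX : ∀ s ∈ uIcc 0 t, b =ᶠ[comap x (𝓝 (x (γ s)))] X ∘ x := fun s hs =>
    eventually_comap.2 <| (eventually_nhdsSet_iff_forall.1 hXb _ (mem_image_of_mem _ hs)).mono
      fun z hz q hq => (hz q hq).trans (congrArg X hq.symm)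
  have heq := h.eqOn_globalFlow (hX.of_le (by simp)) hΨ fun s hs heq => heq ▸ hbX s hs
  exact ⟨X, Ψ, hX, hΨ, fun s hs =>
    (show x (γ s) = Ψ (x p, s) from heq hs) ▸ hbX s hs⟩

end IsTrajectory

/-- The set of pairs `(p, t)` such that a trajectory starting at `p` exists until the time `t`. -/
def flowDomain (x b : M → E) : Set (M × ℝ) := {z | ∃ γ, IsTrajectory x b z.1 z.2 γ}

open Classical in
/-- The flow of the vector field `b` along the map `x`, with the junk value `z.1` at points `z`
outside of `flowDomain x b`. -/
noncomputable def flowMap (x b : M → E) (z : M × ℝ) : M :=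
  if h : z ∈ flowDomain x b then h.choose z.2 else z.1

theorem IsTrajectory.flowMap_eq (hx : Function.Injective x) (hb : IsSmoothAlong x b)
    (h : IsTrajectory x b p t γ) : flowMap x b (p, t) = γ t := by
  have hz : (p, t) ∈ flowDomain x b := ⟨γ, h⟩
  rw [flowMap, dif_pos hz]
  exact hz.choose_spec.eqOn hx hb h right_mem_uIcc

theorem zero_mem_flowDomain (x b : M → E) (p : M) : (p, (0 : ℝ)) ∈ flowDomain x b :=
  ⟨_, .const x b p⟩

theorem flowMap_zero (hx : Function.Injective x) (hb : IsSmoothAlong x b) (p : M) :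
    flowMap x b (p, 0) = p :=
  (IsTrajectory.const x b p).flowMap_eq hx hb

theorem isConnected_flowDomain_fiber (x b : M → E) (p : M) :
    IsConnected {t : ℝ | (p, t) ∈ flowDomain x b} :=
  ⟨⟨0, zero_mem_flowDomain x b p⟩, isPreconnected_of_forall 0 fun t ⟨γ, hγ⟩ =>
    ⟨uIcc 0 t, fun _ hs => ⟨γ, hγ.mono hs⟩, left_mem_uIcc, right_mem_uIcc, isPreconnected_uIcc⟩⟩

/-- Since `Ψ` is continuous and intervals of times are compact, the extension of `b` around one
trajectory works for all trajectories nearby. -/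
theorem exists_isGlobalFlow_eventually_flowMap_eq [FiniteDimensional ℝ E]
    (hx : Function.Injective x) (hb : IsSmoothAlong x b) {z₀ : M × ℝ} (hz₀ : z₀ ∈ flowDomain x b) :
    ∃ X Ψ, ContDiff ℝ ∞ X ∧ IsGlobalFlow X Ψ ∧
      ∀ᶠ z in comap (Prod.map x id) (𝓝 (Prod.map x id z₀)), z ∈ flowDomain x b →
        x (flowMap x b z) = Ψ (Prod.map x id z) ∧
          b (flowMap x b z) = X (x (flowMap x b z)) := by
  obtain ⟨γ₀, hγ₀⟩ := hz₀
  obtain ⟨X, Ψ, hX, hΨ, hbX⟩ := hγ₀.exists_isGlobalFlow hb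
  have := FiniteDimensional.complete ℝ E
  have huIcc : ∀ t : ℝ, uIcc 0 t = (· * t) '' uIcc 0 1 := fun t => by
    rw [image_mul_const_uIcc, zero_mul, one_mul]
  have htube : ∀ᶠ z : E × ℝ in 𝓝 (Prod.map x id z₀), ∀ θ ∈ uIcc (0 : ℝ) 1,
      b =ᶠ[comap x (𝓝 (Ψ (z.1, θ * z.2)))] X ∘ x := by
    refine isCompact_uIcc.eventually_forall_of_forall_eventually fun θ hθ => ?_
    have hcont : Continuous fun y : (E × ℝ) × ℝ => Ψ (y.1.1, y.2 * y.1.2) :=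
      (hΨ.contDiff hX).continuous.comp (by fun_prop)
    have hθ' : θ * z₀.2 ∈ uIcc 0 z₀.2 := huIcc z₀.2 ▸ mem_image_of_mem _ hθ
    exact hcont.continuousAt.eventually (eventually_comap.1 (hbX _ hθ')).eventually_nhds
      |>.mono fun _ => eventually_comap.2
  refine ⟨X, Ψ, hX, hΨ, (tendsto_comap.eventually htube).mono ?_⟩
  rintro ⟨p, t⟩ hpt ⟨γ, hγ⟩
  have hbX' : ∀ s ∈ uIcc 0 t, b =ᶠ[comap x (𝓝 (Ψ (x p, s)))] X ∘ x := by
    rw [huIcc]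
    exact forall_mem_image.2 hpt
  have hflow : x (flowMap x b (p, t)) = Ψ (x p, t) := by
    rw [hγ.flowMap_eq hx hb]
    exact hγ.eqOn_globalFlow (hX.of_le (by simp)) hΨ (fun s hs _ => hbX' s hs) right_mem_uIcc
  exact ⟨hflow, eq_of_eventuallyEq_comap (hflow ▸ hbX' t right_mem_uIcc)⟩

theorem isSmoothAlong_flowMap [FiniteDimensional ℝ E] (hx : Function.Injective x)
    (hb : IsSmoothAlong x b) :
    IsSmoothAlong (fun w : flowDomain x b => Prod.map x id (w : M × ℝ))
      fun w => x (flowMap x b w) := by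
  have := FiniteDimensional.complete ℝ E
  intro w
  obtain ⟨X, Ψ, hX, hΨ, h⟩ := exists_isGlobalFlow_eventually_flowMap_eq hx hb w.2
  refine ⟨Ψ, hΨ.contDiff hX, ?_⟩
  filter_upwards [(tendsto_comap_iff.2 tendsto_comap).eventually h] with z hz using (hz z.2).1

theorem hasDerivWithinAt_flowMap [FiniteDimensional ℝ E] (hx : Function.Injective x)
    (hb : IsSmoothAlong x b) (h : (p, t) ∈ flowDomain x b) :
    HasDerivWithinAt (fun s => x (flowMap x b (p, s))) (b (flowMap x b (p, t)))
      {s | (p, s) ∈ flowDomain x b} t := by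
  obtain ⟨X, Ψ, -, hΨ, hflow⟩ := exists_isGlobalFlow_eventually_flowMap_eq hx hb h
  have hpt := eventually_comap.1 hflow |>.self_of_nhds _ rfl h
  have hd : HasDerivAt (fun s => Ψ (x p, s)) (b (flowMap x b (p, t))) t := by
    rw [hpt.2, hpt.1]
    exact hΨ.hasDerivAt _ _
  have hs : Tendsto (Prod.mk p) (𝓝 t) (comap (Prod.map x id) (𝓝 (Prod.map x id (p, t)))) :=
    tendsto_comap_iff.2 ((Continuous.prodMk_right (x p)).tendsto t)
  refine hd.hasDerivWithinAt.congr_of_eventuallyEq_of_mem ?_ h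
  filter_upwards [(hs.eventually hflow).filter_mono nhdsWithin_le_nhds, self_mem_nhdsWithin]
    with s hs hsW using (hs hsW).1

end Trajectory

theorem hasDerivOnAt_iff {J : Set ℝ} {f : ℝ → ℝ} {g : J → ℝ} (h : ∀ s : J, f s = g s) {c : ℝ}
    {t : J} : HasDerivOnAt J g c t ↔ HasDerivWithinAt f c J t := by
  have hfg : EqOn (Function.extend Subtype.val g 0) f J := fun s hs =>
    (Subtype.val_injective.extend_apply g 0 ⟨s, hs⟩).trans (h ⟨s, hs⟩).symm
  exact ⟨fun hd => hd.congr_of_mem hfg.symm t.2, fun hd => hd.congr_of_mem hfg t.2⟩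

section DerivationFlow

variable {M E : Type*} [NormedAddCommGroup E] [NormedSpace ℝ E] [FiniteDimensional ℝ E]
  {F : DifferentialStructure M} {x : M → E}

theorem IsIntegralCurve.exists_isTrajectory (hx : IsSmoothEmbedding F x)
    {v : Derivation ℝ F.toSubalgebra F.toSubalgebra} {K : Set ℝ} {τ : K → M}
    (hτ : IsIntegralCurve v K τ) (t : K) :
    ∃ γ, IsTrajectory x (hx.vectorField v) (τ ⟨0, hτ.zero_mem⟩) t γ ∧ γ t = τ t := by
  rcases hτ.deriv_eq with hK | ⟨-, hd⟩
  · obtain rfl : t = ⟨0, hτ.zero_mem⟩ := Subtype.ext (hK t.2 hτ.zero_mem)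
    exact ⟨_, .const _ _ _, rfl⟩
  let γ : ℝ → M := Function.extend Subtype.val τ fun _ => τ t
  have hγ : ∀ s : K, γ s = τ s := Subtype.val_injective.extend_apply τ _
  have hsub : uIcc 0 (t : ℝ) ⊆ K :=
    hτ.connected.isPreconnected.ordConnected.uIcc_subset hτ.zero_mem t.2
  refine ⟨γ, ⟨hγ ⟨0, hτ.zero_mem⟩, fun s hs => ?_⟩, hγ t⟩
  have hcoord i : HasDerivWithinAt (fun r => coordinate E i (x (γ r)))
      ((v (hx.pullback (coordinate E i) (coordinate E i).contDiff) : M → ℝ) (γ s)) K s := by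
    rw [hγ ⟨s, hsub hs⟩]
    exact (hasDerivOnAt_iff fun r => by rw [hγ r]; rfl).1 (hd _ ⟨s, hsub hs⟩)
  have hsum := HasDerivWithinAt.fun_sum (u := Finset.univ) fun i _ =>
    (hcoord i).smul_const (Module.finBasis ℝ E i)
  simp only [sum_coordinate_smul] at hsum
  exact hsum.mono hsub

namespace IsSmoothEmbedding

variable (hx : IsSmoothEmbedding F x) (v : Derivation ℝ F.toSubalgebra F.toSubalgebra)

theorem isSmooth_flowMap :
    IsSmooth ((F.prod (standard ℝ)).subspace (flowDomain x (hx.vectorField v))) F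
      fun w => flowMap x (hx.vectorField v) w :=
  hx.isSmooth (clm_comp_prodMap_mem (fun l => hx.contDiff_comp_mem l.contDiff)
    (fun l => clm_mem_standard l) _)
    (isSmoothAlong_flowMap hx.injective (hx.isSmoothAlong_vectorField v))

theorem isSmooth_flowMap_curve (p : M) :
    IsSmooth ((standard ℝ).subspace {t : ℝ | (p, t) ∈ flowDomain x (hx.vectorField v)}) F
      fun t => flowMap x (hx.vectorField v) (p, t) :=
  hx.isSmooth (fun l => restrict_mem_subspace (clm_mem_standard l) _)
    ((isSmoothAlong_flowMap hx.injective (hx.isSmoothAlong_vectorField v)).comp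
      (φ := fun t : {t : ℝ | (p, t) ∈ flowDomain x (hx.vectorField v)} => ⟨(p, t), t.2⟩)
      (isSmoothAlong_of_contDiff (g := fun s : ℝ => (x p, s)) (by fun_prop) _))

theorem hasDerivOnAt_flowMap (f : F.toSubalgebra) (p : M)
    (t : {t : ℝ | (p, t) ∈ flowDomain x (hx.vectorField v)}) :
    HasDerivOnAt _ (fun s => (f : M → ℝ) (flowMap x (hx.vectorField v) (p, s)))
      ((v f : M → ℝ) (flowMap x (hx.vectorField v) (p, t))) t := by
  refine (hasDerivOnAt_iff (f := fun s => (f : M → ℝ) (flowMap x (hx.vectorField v) (p, s)))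
    fun _ => rfl).2 ?_
  have hd := hasDerivWithinAt_flowMap hx.injective (hx.isSmoothAlong_vectorField v) t.2
  obtain ⟨g, hg, hfg⟩ := (hx.mem_iff f).1 f.2 (flowMap x (hx.vectorField v) (p, t))
  have hgd := (hg.differentiable (by simp) _).hasFDerivAt.comp_hasDerivWithinAt (t : ℝ) hd
  rw [← hx.derivation_apply v hg hfg] at hgd
  exact hgd.congr_of_eventuallyEq_of_mem
    ((tendsto_comap_iff.2 hd.continuousWithinAt).eventually hfg) t.2

theorem isMaximalIntegralCurve_flowMap (p : M) :
    IsMaximalIntegralCurve v {t : ℝ | (p, t) ∈ flowDomain x (hx.vectorField v)}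
      fun t => flowMap x (hx.vectorField v) (p, t) where
  zero_mem := zero_mem_flowDomain _ _ _
  connected := isConnected_flowDomain_fiber _ _ p
  deriv_eq := .inr ⟨hx.isSmooth_flowMap_curve v p, fun f => hx.hasDerivOnAt_flowMap v f p⟩
  maximal K τ hτ hτp := by
    have hb := hx.isSmoothAlong_vectorField v
    rw [flowMap_zero hx.injective hb] at hτp
    have htraj := hτp ▸ hτ.exists_isTrajectory hx
    refine ⟨fun t ht => (htraj ⟨t, ht⟩).imp fun _ => And.left, fun t => ?_⟩
    obtain ⟨γ, hγ, hγt⟩ := htraj t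
    rw [hγ.flowMap_eq hx.injective hb, hγt]

theorem isFlow_flowMap :
    IsFlow v (flowDomain x (hx.vectorField v)) fun w => flowMap x (hx.vectorField v) w where
  smooth := hx.isSmooth_flowMap v
  zero_mem := zero_mem_flowDomain _ _
  map_zero := flowMap_zero hx.injective (hx.isSmoothAlong_vectorField v)
  connected := isConnected_flowDomain_fiber _ _
  maximal := hx.isMaximalIntegralCurve_flowMap v

end IsSmoothEmbedding

end DerivationFlow

namespace IsFlow

variable {M : Type*} {F : DifferentialStructure M}
  {v : Derivation ℝ F.toSubalgebra F.toSubalgebra} {W W' : Set (M × ℝ)} {Φ : W → M} {Φ' : W' → M}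

theorem exists_restrict (h : IsFlow v W Φ) (h' : IsFlow v W' Φ') :
    ∃ hW : W' ⊆ W, ∀ w : W', Φ ⟨w, hW w.2⟩ = Φ' w := by
  have hcurve := fun p => (h.maximal p).maximal _ _ (h'.maximal p).toIsIntegralCurve
    ((h'.map_zero p).trans (h.map_zero p).symm)
  exact ⟨fun w hw => (hcurve w.1).1 hw, fun w => (hcurve w.1.1).2 ⟨w.1.2, w.2⟩⟩

theorem unique (h : IsFlow v W Φ) (h' : IsFlow v W' Φ') :
    (⟨W, Φ⟩ : Σ W : Set (M × ℝ), (W → M)) = ⟨W', Φ'⟩ := by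
  obtain ⟨hW, hΦ⟩ := h.exists_restrict h'
  obtain ⟨hW', -⟩ := h'.exists_restrict h
  obtain rfl := hW.antisymm hW'
  exact congrArg (Sigma.mk W') (funext hΦ)

end IsFlow

end Sikorski

theorem theorem3p12 {M : Type*} (F : Sikorski.DifferentialStructure M)
    (hM : ∃ (n : ℕ) (S : Set (EuclideanSpace ℝ (Fin n))),
      Sikorski.Diffeomorphic F
        ((Sikorski.DifferentialStructure.standard (EuclideanSpace ℝ (Fin n))).subspace S))
    (v : Derivation ℝ F.toSubalgebra F.toSubalgebra) :
    ∃! p : (Σ W : Set (M × ℝ), (W → M)), Sikorski.IsFlow v p.1 p.2 := by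
  obtain ⟨n, S, hS⟩ := hM
  obtain ⟨x, hx⟩ := hS.exists_isSmoothEmbedding
  exact ⟨_, hx.isFlow_flowMap v, fun p hp => hp.unique (hx.isFlow_flowMap v)⟩
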